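/- Let $k$ be a field. An Akivis algebra over $k$ is a $k$-vector space $A$ with a bilinear product $[x,y]$ satisfying $[x,x]=0$ and a trilinear product $(x,y,z)$ such that $$[[x,y],z]+[[y,z],x]+[[z,x],y]=(x,y,z)+(z,x,y)+(y,z,x)-(x,z,y)-(y,x,z)-(z,y,x).$$ Every (not necessarily associative or unital) $k$-algebra $B$ gives an Akivis algebra $Ak(B)$ with $[x,y]=xy-yx$ and $(x,y,z)=(xy)z-x(yz)$. An Akivis algebra is called linear if it embeds into $Ak(B)$ for some $B$. For a set $X$, let $M(X)$ be the free non-associative $k$-algebra on $X$, with linear basis the set $X^{**}$ of non-associative words in $X$, and let $M(X\mid R)$ be its quotient by the ideal generated by $R$. If $X$ is linearly ordered, order $X^{**}$ by the degree-lexicographic order: shorter words are smaller; letters are compared as in $X$; and $(u_1u_2)<(v_1v_2)$ for words of equal length iff $u_1<v_1$, or $u_1=v_1$ and $u_2<v_2$. For $0\ne f\in M(X)$ let $\bar f$ be its leading word; $f$ is monic if $\bar f$ has coefficient $1$. A set $S\subset M(X)$ of monic polynomials is a Gröbner–Shirshov basis if, whenever $f,g\in S$ and $\bar f=(a\bar g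 b)$ (that is, $\bar g$ occurs as a subword of $\bar f$), the composition $f-(agb)$ is trivial modulo $(S,\bar f)$, i.e. is a linear combination of elements $(a's b')$ with $s\in S$ and $(a'\bar s b')<\bar f$. **Theorem.** Let $A$ be an Akivis algebra over $k$. (1) Let $\{e_i\mid i\in I\}$ be a linearly ordered basis of $A$. Write $\{e_ie_j\}$ and $\{e_ie_je_l\}$ for the linear polynomials in the letters $e_m$ that express $[e_i,e_j]$ and $(e_i,e_j,e_l)$ in this basis, and let $$U(A)=M(\{e_i\}_{I}\mid e_ie_j-e_je_i=\{e_ie_j\},\ (e_ie_j)e_l-e_i(e_je_l)=\{e_ie_je_l\},\ i,j,l\in I)$$ be the universal enveloping algebra of $A$. Let $S\subset M(\{e_i\}_I)$ consist of the polynomials - $e_ie_j-e_je_i-\{e_ie_j\}$ for $i>j$, - $(e_ie_j)e_l-e_i(e_je_l)-\{e_ie_je_l\}$ for $i,j,l\in I$, - $e_i(e_je_l)-e_j(e_ie_l)-\{e_ie_j\}e_l-\{e_je_ie_l\}+\{e_ie_je_l\}$ for $i>j$, $l\ge j$. Then: (i) $S$ is a Gröbner–Shirshov basis for $U(A)$: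 the degree-lexicographic order is a linear order compatible with multiplication (and a well order if $I$ is well ordered), $S$ is a Gröbner–Shirshov basis in $M(\{e_i\}_I)$ with respect to it, and $S$ generates the same ideal as the defining relations of $U(A)$, so that $U(A)=M(\{e_i\}_I\mid S)$. (ii) $A$ embeds into $U(A)$: the linear map $A\to U(A)$, $e_i\mapsto e_i$, is injective and is a homomorphism of Akivis algebras $A\to Ak(U(A))$. (2) Consequently every Akivis algebra is linear. -/

import Mathlib

noncomputable section

/-- The structure of an Akivis algebra on a vector space `A` over a field `k`: a bilinear
skew-symmetric (`[x,x] = 0`) product and a trilinear product linked by the Akivis identity. -/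
structure AkivisAlgebra (k A : Type*) [Field k] [AddCommGroup A] [Module k A] where
  /-- the product `[x,y]` -/
  br : A →ₗ[k] A →ₗ[k] A
  /-- the product `(x,y,z)` -/
  tri : A →ₗ[k] A →ₗ[k] A →ₗ[k] A
  br_self : ∀ x, br x x = 0
  akivis : ∀ x y z,
    br (br x y) z + br (br y z) x + br (br z x) y =
      tri x y z + tri z x y + tri y z x - tri x z y - tri y x z - tri z y x

namespace AkivisAlgebra

/-- The Akivis algebra `Ak(B)` of a non-associative algebra `B`, with `[x,y] = xy - yx` and
`(x,y,z) = (xy)z - x(yz)`. -/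
def ofAlgebra (k B : Type*) [Field k] [NonUnitalNonAssocRing B] [Module k B]
    [IsScalarTower k B B] [SMulCommClass k B B] : AkivisAlgebra k B where
  br := LinearMap.mk₂ k (fun x y => x * y - y * x)
    (fun x y z => by simp only [add_mul, mul_add]; abel)
    (fun c x y => by simp only [smul_mul_assoc, mul_smul_comm, smul_sub])
    (fun x y z => by simp only [add_mul, mul_add]; abel)
    (fun c x y => by simp only [smul_mul_assoc, mul_smul_comm, smul_sub])
  tri := LinearMap.mk₂ k
    (fun x y => LinearMap.mulLeft k (x * y) - LinearMap.mulLeft k x ∘ₗ LinearMap.mulLeft k y)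
    (fun x y z => by ext w; simp [add_mul]; abel)
    (fun c x y => by ext w; simp [smul_mul_assoc, smul_sub])
    (fun x y z => by ext w; simp [add_mul, mul_add]; abel)
    (fun c x y => by ext w; simp [smul_mul_assoc, mul_smul_comm, smul_sub])
  br_self x := by simp
  akivis x y z := by
    simp
    abel

/-- `f` is a homomorphism of Akivis algebras. -/
def IsHom {k A B : Type*} [Field k] [AddCommGroup A] [Module k A] [AddCommGroup B] [Module k B]
    (P : AkivisAlgebra k A) (Q : AkivisAlgebra k B) (f : A →ₗ[k] B) : Prop :=
  (∀ x y, f (P.br x y) = Q.br (f x) (f y)) ∧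
    ∀ x y z, f (P.tri x y z) = Q.tri (f x) (f y) (f z)

/-- `A` is linear: it embeds into `Ak(B)` for some non-associative algebra `B`. -/
def IsLinear.{u, v} {k : Type u} {A : Type v} [Field k] [AddCommGroup A] [Module k A]
    (P : AkivisAlgebra k A) : Prop :=
  ∃ (B : Type (max u v)) (_ : NonUnitalNonAssocRing B) (_ : Module k B)
    (_ : IsScalarTower k B B) (_ : SMulCommClass k B B) (f : A →ₗ[k] B),
    Function.Injective f ∧ IsHom P (ofAlgebra k B) f

end AkivisAlgebra

namespace NonassocGS

/-! ### Ideals and presentations of non-associative algebras -/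

section Ideal

variable {k M : Type*} [Field k] [NonUnitalNonAssocRing M] [Module k M]

/-- The two-sided ideal of the `k`-algebra `M` generated by `S`: the least `k`-subspace that
contains `S` and is closed under left and right multiplication by elements of `M`. -/
def idealSpan (k : Type*) {M : Type*} [Field k] [NonUnitalNonAssocRing M] [Module k M]
    (S : Set M) : Submodule k M :=
  sInf {J | S ⊆ J ∧ ∀ a x, x ∈ J → a * x ∈ J ∧ x * a ∈ J}

theorem mul_mem_idealSpan (S : Set M) (a : M) {x : M} (hx : x ∈ idealSpan k S) :
    a * x ∈ idealSpan k S ∧ x * a ∈ idealSpan k S := by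
  simp only [idealSpan, Submodule.mem_sInf, Set.mem_ofPred_eq] at hx ⊢
  exact ⟨fun J hJ => (hJ.2 a x (hx J hJ)).1, fun J hJ => (hJ.2 a x (hx J hJ)).2⟩

end Ideal

/-- The free non-associative algebra `M(X)`; its linear basis is the set `FreeMagma X` of
non-associative words in `X`. -/
abbrev Free (k X : Type*) [Field k] := FreeNonUnitalNonAssocAlgebra k X

/-- `M(X | R)`, the non-associative algebra with generators `X` and defining relations `r = 0`
for `r ∈ R`. -/
def Presented {k X : Type*} [Field k] (R : Set (Free k X)) : Type _ :=
  Free k X ⧸ idealSpan k R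

namespace Presented

variable {k X : Type*} [Field k] (R : Set (Free k X))

instance : AddCommGroup (Presented R) := inferInstanceAs (AddCommGroup (Free k X ⧸ idealSpan k R))

instance : Module k (Presented R) := inferInstanceAs (Module k (Free k X ⧸ idealSpan k R))

/-- The quotient map `M(X) → M(X | R)`. -/
def mk : Free k X →ₗ[k] Presented R := (idealSpan k R).mkQ

theorem mk_surjective : Function.Surjective (mk R) := (idealSpan k R).mkQ_surjective

theorem mk_eq_mk {a b : Free k X} : mk R a = mk R b ↔ a - b ∈ idealSpan k R :=
  Submodule.Quotient.eq _

instance : Mul (Presented R) where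
  mul := Quotient.map₂ (· * ·) fun a b hab c d hcd => by
    replace hab : a - b ∈ idealSpan k R := (Submodule.quotientRel_def _).1 hab
    replace hcd : c - d ∈ idealSpan k R := (Submodule.quotientRel_def _).1 hcd
    refine (Submodule.quotientRel_def _).2 ?_
    have h : a * c - b * d = (a - b) * c + b * (c - d) := by rw [sub_mul, mul_sub]; abel
    rw [h]
    exact add_mem (mul_mem_idealSpan R c hab).2 (mul_mem_idealSpan R b hcd).1

theorem mk_mul (a b : Free k X) : mk R (a * b) = mk R a * mk R b := rfl

instance : NonUnitalNonAssocRing (Presented R) :=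
  { (inferInstance : AddCommGroup (Presented R)), (inferInstance : Mul (Presented R)) with
    left_distrib := by
      intro a b c
      obtain ⟨a, rfl⟩ := mk_surjective R a
      obtain ⟨b, rfl⟩ := mk_surjective R b
      obtain ⟨c, rfl⟩ := mk_surjective R c
      change mk R a * (mk R b + mk R c) = mk R a * mk R b + mk R a * mk R c
      rw [← map_add, ← mk_mul, ← mk_mul, ← mk_mul, mul_add, map_add]
    right_distrib := by
      intro a b c
      obtain ⟨a, rfl⟩ := mk_surjective R a
      obtain ⟨b, rfl⟩ := mk_surjective R b
      obtain ⟨c, rfl⟩ := mk_surjective R c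
      change (mk R a + mk R b) * mk R c = mk R a * mk R c + mk R b * mk R c
      rw [← map_add, ← mk_mul, ← mk_mul, ← mk_mul, add_mul, map_add]
    zero_mul := by
      intro a
      obtain ⟨a, rfl⟩ := mk_surjective R a
      change (0 : Presented R) * mk R a = 0
      rw [← map_zero (mk R), ← mk_mul, zero_mul]
    mul_zero := by
      intro a
      obtain ⟨a, rfl⟩ := mk_surjective R a
      change mk R a * (0 : Presented R) = 0
      rw [← map_zero (mk R), ← mk_mul, mul_zero] }

instance : IsScalarTower k (Presented R) (Presented R) where
  smul_assoc c a b := by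
    obtain ⟨a, rfl⟩ := mk_surjective R a
    obtain ⟨b, rfl⟩ := mk_surjective R b
    rw [smul_eq_mul, smul_eq_mul, ← map_smul, ← mk_mul, ← mk_mul, ← map_smul, smul_mul_assoc]

instance : SMulCommClass k (Presented R) (Presented R) where
  smul_comm c a b := by
    obtain ⟨a, rfl⟩ := mk_surjective R a
    obtain ⟨b, rfl⟩ := mk_surjective R b
    rw [smul_eq_mul, smul_eq_mul, ← map_smul, ← mk_mul, ← mk_mul, ← map_smul, mul_smul_comm]

end Presented

/-! ### Orders on non-associative words -/

/-- The degree-lexicographic order on non-associative words over a linearly ordered alphabet: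
compare lengths first; letters are compared in the alphabet, and products `(u₁ u₂)`, `(v₁ v₂)` of
equal length by `u₁, v₁` first and then by `u₂, v₂`. -/
def DegLex {X : Type*} [LinearOrder X] : FreeMagma X → FreeMagma X → Prop
  | .of i, .of j => i < j
  | .of _, .mul _ _ => True
  | .mul _ _, .of _ => False
  | .mul u₁ u₂, .mul v₁ v₂ =>
    u₁.length + u₂.length < v₁.length + v₂.length ∨
      (u₁.length + u₂.length = v₁.length + v₂.length ∧
        (DegLex u₁ v₁ ∨ (u₁ = v₁ ∧ DegLex u₂ v₂)))

/-- `lt` is a strict linear order on words that is compatible with multiplication. -/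
structure IsMonomialOrder {X : Type*} (lt : FreeMagma X → FreeMagma X → Prop) : Prop where
  strictTotal : IsStrictTotalOrder (FreeMagma X) lt
  mul_right : ∀ u v w, lt u v → lt (u * w) (v * w)
  mul_left : ∀ u v w, lt u v → lt (w * u) (w * v)

/-! ### Gröbner–Shirshov bases in the free non-associative algebra -/

/-- A non-associative word in which exactly one place is left open. -/
inductive Context (X : Type*)
  /-- the open place alone -/
  | hole : Context X
  /-- `(w c)` -/
  | left (w : FreeMagma X) (c : Context X) : Context X
  /-- `(c w)` -/
  | right (c : Context X) (w : FreeMagma X) : Context X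

namespace Context

variable {X : Type*}

/-- The word `(a v b)`. -/
def word : Context X → FreeMagma X → FreeMagma X
  | hole, v => v
  | left w c, v => w * c.word v
  | right c w, v => c.word v * w

/-- The polynomial `(a f b)`; for `f ∈ S` this is an `S`-word. -/
def poly {k : Type*} [Field k] : Context X → Free k X → Free k X
  | hole, f => f
  | left w c, f => MonoidAlgebra.single w 1 * c.poly f
  | right c w, f => c.poly f * MonoidAlgebra.single w 1

end Context

section GSB

variable {k X : Type*} [Field k]

/-- `w` is the leading word of `f`. -/
def IsLeadingWord (lt : FreeMagma X → FreeMagma X → Prop) (f : Free k X) (w : FreeMagma X) : Prop :=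
  w ∈ f.coeff.support ∧ ∀ v ∈ f.coeff.support, v ≠ w → lt v w

/-- `f` is trivial modulo `(S, w)`: it is a linear combination of `S`-words `(a s b)` whose words
`(a s̄ b)` are smaller than `w`. -/
def TrivialMod (lt : FreeMagma X → FreeMagma X → Prop) (S : Set (Free k X)) (w : FreeMagma X)
    (f : Free k X) : Prop :=
  f ∈ Submodule.span k
    {h | ∃ s ∈ S, ∃ v, IsLeadingWord lt s v ∧ ∃ c : Context X, lt (c.word v) w ∧ h = c.poly s}

/-- `S` is a Gröbner–Shirshov basis in `M(X)` with respect to the monomial order `lt`: it consists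
of monic polynomials, and every composition (of inclusion) `f - (a g b)`, where `f, g ∈ S` and
`f̄ = (a ḡ b)`, is trivial modulo `(S, f̄)`. -/
structure IsGroebnerShirshovBasis (lt : FreeMagma X → FreeMagma X → Prop) (S : Set (Free k X)) :
    Prop where
  monomialOrder : IsMonomialOrder lt
  monic : ∀ s ∈ S, ∃ w, IsLeadingWord lt s w ∧ s.coeff w = 1
  trivial : ∀ f ∈ S, ∀ g ∈ S, ∀ w v, IsLeadingWord lt f w → IsLeadingWord lt g v →
    ∀ c : Context X, w = c.word v → TrivialMod lt S w (f - c.poly g)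

end GSB

end NonassocGS

namespace AkivisAlgebra

open NonassocGS

section Envelope

variable {k A I : Type*} [Field k] [AddCommGroup A] [Module k A]

/-- The letter `e_i` of `M({e_i})`; the alphabet is indexed by `I`. -/
abbrev letter (k : Type*) {I : Type*} [Field k] (i : I) : Free k I :=
  FreeNonUnitalNonAssocAlgebra.of k i

/-- The linear map `A → M({e_i})` that sends `∑ αᵢ eᵢ` to the linear polynomial `∑ αᵢ eᵢ`. -/
def lin (e : Module.Basis I k A) : A →ₗ[k] Free k I :=
  Finsupp.linearCombination k (letter k) ∘ₗ e.repr.toLinearMap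

/-- The polynomial `{e_i e_j}`. -/
def brPoly (P : AkivisAlgebra k A) (e : Module.Basis I k A) (i j : I) : Free k I :=
  lin e (P.br (e i) (e j))

/-- The polynomial `{e_i e_j e_l}`. -/
def triPoly (P : AkivisAlgebra k A) (e : Module.Basis I k A) (i j l : I) : Free k I :=
  lin e (P.tri (e i) (e j) (e l))

/-- The polynomial `e_i e_j - e_j e_i - {e_i e_j}`. -/
def commRel (P : AkivisAlgebra k A) (e : Module.Basis I k A) (i j : I) : Free k I :=
  letter k i * letter k j - letter k j * letter k i - P.brPoly e i j

/-- The polynomial `(e_i e_j) e_l - e_i (e_j e_l) - {e_i e_j e_l}`. -/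
def assocRel (P : AkivisAlgebra k A) (e : Module.Basis I k A) (i j l : I) : Free k I :=
  letter k i * letter k j * letter k l - letter k i * (letter k j * letter k l) - P.triPoly e i j l

/-- The polynomial
`e_i (e_j e_l) - e_j (e_i e_l) - {e_i e_j} e_l - {e_j e_i e_l} + {e_i e_j e_l}`. -/
def derivedRel (P : AkivisAlgebra k A) (e : Module.Basis I k A) (i j l : I) : Free k I :=
  letter k i * (letter k j * letter k l) - letter k j * (letter k i * letter k l)
    - P.brPoly e i j * letter k l - P.triPoly e j i l + P.triPoly e i j l

/-- The defining relations of the universal enveloping algebra. -/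
def envRel (P : AkivisAlgebra k A) (e : Module.Basis I k A) : Set (Free k I) :=
  {f | ∃ i j, f = P.commRel e i j} ∪ {f | ∃ i j l, f = P.assocRel e i j l}

/-- The universal enveloping algebra `U(A)`. -/
abbrev Env (P : AkivisAlgebra k A) (e : Module.Basis I k A) : Type _ :=
  Presented (P.envRel e)

/-- The canonical map `A → U(A)`, sending the basis vector `e_i` to the generator `e_i`. -/
def toEnv (P : AkivisAlgebra k A) (e : Module.Basis I k A) : A →ₗ[k] P.Env e :=
  Presented.mk (P.envRel e) ∘ₗ lin e

/-- The set `S`. -/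
def gsSet [LinearOrder I] (P : AkivisAlgebra k A) (e : Module.Basis I k A) : Set (Free k I) :=
  {f | ∃ i j, j < i ∧ f = P.commRel e i j} ∪
    {f | ∃ i j l, f = P.assocRel e i j l} ∪
    {f | ∃ i j l, j < i ∧ j ≤ l ∧ f = P.derivedRel e i j l}

end Envelope

end AkivisAlgebra

end

namespace NonassocGS

/-! ### The degree-lexicographic order -/

/-! The leading words of $S$ are $e_ie_j$ with $i>j$, all $(e_ie_j)e_l$, and $e_i(e_je_l)$ with
$i>j\le l$. A proper subword of one of them is a letter or a word of length two, so a composition of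
distinct elements must insert $e_ie_j$ into $(e_ie_j)e_l$: the other candidate, $e_je_l$ inside
$e_i(e_je_l)$, would need $j>l$. Modulo `assocRel e j i l` that composition is the third relation
for $(i,j,l)$ up to sign (`derivedRel_eq`). For $j\le l$ it belongs to $S$. For $i>j>l$ it does not,
but sorting $e_i(e_je_l)$ and $e_j(e_ie_l)$ down to $e_l(e_je_i)$ leaves exactly the Akivis identity
as linear remainder (`derivedRel_expansion`).

Injectivity of $A\to U(A)$ does not go through a composition-diamond lemma. Instead a concrete
algebra on $A\oplus V$ is built, where $V$ contains the symmetric square of $A$. A product of two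
vectors of $A$ is half of the bracket plus their symmetric product; the actions of $A$ on $V$ take
values in $A\oplus V$ and are forced by the associator relation once sorted triples are sent to
zero; $V\cdot V=0$. The forced values are consistent by the Akivis identity again, needed only for
$i>j>l$ (`rightBasis_sub_leftBasis`). This algebra satisfies the relations of $U(A)$ and contains
$A$, so no nonzero vector of $A$ dies in $U(A)$. -/

theorem length_of {X : Type*} (i : X) : (FreeMagma.of i).length = 1 := rfl

theorem length_mul {X : Type*} (u v : FreeMagma X) : (u * v).length = u.length + v.length := rfl

section DegLexOrder

variable {X : Type*} [LinearOrder X]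

theorem degLex_of_of {i j : X} : DegLex (FreeMagma.of i) (FreeMagma.of j) ↔ i < j := by
  simp only [DegLex]

theorem degLex_of_mul (i : X) (v w : FreeMagma X) : DegLex (FreeMagma.of i) (v * w) := by
  change DegLex (FreeMagma.of i) (FreeMagma.mul v w)
  simp only [DegLex]

theorem not_degLex_mul_of (v w : FreeMagma X) (i : X) : ¬ DegLex (v * w) (FreeMagma.of i) := by
  change ¬ DegLex (FreeMagma.mul v w) (FreeMagma.of i)
  simp only [DegLex, not_false_eq_true]

theorem degLex_mul_mul {u₁ u₂ v₁ v₂ : FreeMagma X} :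
    DegLex (u₁ * u₂) (v₁ * v₂) ↔
      u₁.length + u₂.length < v₁.length + v₂.length ∨
      (u₁.length + u₂.length = v₁.length + v₂.length ∧
        (DegLex u₁ v₁ ∨ (u₁ = v₁ ∧ DegLex u₂ v₂))) := by
  change DegLex (FreeMagma.mul u₁ u₂) (FreeMagma.mul v₁ v₂) ↔ _
  simp only [DegLex]

theorem degLex_of_length_lt {u v : FreeMagma X} (h : u.length < v.length) : DegLex u v := by
  induction u using FreeMagma.recOnMul with
  | ih1 i =>
    induction v using FreeMagma.recOnMul with
    | ih1 j => simp at h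
    | ih2 v₁ v₂ _ _ => exact degLex_of_mul _ _ _
  | ih2 u₁ u₂ _ _ =>
    induction v using FreeMagma.recOnMul with
    | ih1 j =>
      have h₁ := u₁.length_pos
      have h₂ := u₂.length_pos
      rw [length_mul, length_of] at h
      omega
    | ih2 v₁ v₂ _ _ => exact degLex_mul_mul.2 (.inl h)

theorem length_le_of_degLex {u v : FreeMagma X} (h : DegLex u v) : u.length ≤ v.length := by
  induction u using FreeMagma.recOnMul with
  | ih1 i => exact v.length_pos
  | ih2 u₁ u₂ _ _ =>
    induction v using FreeMagma.recOnMul with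
    | ih1 j => exact absurd h (not_degLex_mul_of _ _ _)
    | ih2 v₁ v₂ _ _ =>
      rw [length_mul, length_mul]
      rcases degLex_mul_mul.1 h with h | h
      · exact h.le
      · exact h.1.le

theorem degLex_irrefl (u : FreeMagma X) : ¬ DegLex u u := by
  induction u using FreeMagma.recOnMul with
  | ih1 i => simp [degLex_of_of]
  | ih2 u₁ u₂ h₁ h₂ => simp [degLex_mul_mul, h₁, h₂]

theorem degLex_trans {u v w : FreeMagma X} (huv : DegLex u v) (hvw : DegLex v w) :
    DegLex u w := by
  induction u using FreeMagma.recOnMul generalizing v w with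
  | ih1 i =>
    induction w using FreeMagma.recOnMul with
    | ih2 w₁ w₂ _ _ => exact degLex_of_mul _ _ _
    | ih1 l =>
      induction v using FreeMagma.recOnMul with
      | ih1 j => exact degLex_of_of.2 ((degLex_of_of.1 huv).trans (degLex_of_of.1 hvw))
      | ih2 v₁ v₂ _ _ => exact absurd hvw (not_degLex_mul_of _ _ _)
  | ih2 u₁ u₂ h₁ h₂ =>
    induction v using FreeMagma.recOnMul with
    | ih1 j => exact absurd huv (not_degLex_mul_of _ _ _)
    | ih2 v₁ v₂ _ _ =>
      induction w using FreeMagma.recOnMul with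
      | ih1 l => exact absurd hvw (not_degLex_mul_of _ _ _)
      | ih2 w₁ w₂ _ _ =>
        rw [degLex_mul_mul] at huv hvw ⊢
        rcases huv with huv | ⟨euv, huv⟩
        · rcases hvw with hvw | ⟨evw, _⟩
          · exact .inl (huv.trans hvw)
          · exact .inl (evw ▸ huv)
        · rcases hvw with hvw | ⟨evw, hvw⟩
          · exact .inl (euv ▸ hvw)
          · refine .inr ⟨euv.trans evw, ?_⟩
            rcases huv with huv | ⟨rfl, huv⟩
            · rcases hvw with hvw | ⟨rfl, _⟩
              · exact .inl (h₁ huv hvw)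
              · exact .inl huv
            · rcases hvw with hvw | ⟨rfl, hvw⟩
              · exact .inl hvw
              · exact .inr ⟨rfl, h₂ huv hvw⟩

theorem degLex_trichotomous {u v : FreeMagma X} (huv : ¬ DegLex u v) (hvu : ¬ DegLex v u) :
    u = v := by
  induction u using FreeMagma.recOnMul generalizing v with
  | ih1 i =>
    induction v using FreeMagma.recOnMul with
    | ih1 j =>
      rw [degLex_of_of, not_lt] at huv hvu
      rw [le_antisymm hvu huv]
    | ih2 v₁ v₂ _ _ => exact absurd (degLex_of_mul _ _ _) huv
  | ih2 u₁ u₂ h₁ h₂ =>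
    induction v using FreeMagma.recOnMul with
    | ih1 j => exact absurd (degLex_of_mul _ _ _) hvu
    | ih2 v₁ v₂ _ _ =>
      rw [degLex_mul_mul] at huv hvu
      push Not at huv hvu
      have e := le_antisymm hvu.1 huv.1
      obtain ⟨a₁, a₂⟩ := huv.2 e
      obtain ⟨b₁, b₂⟩ := hvu.2 e.symm
      obtain rfl := h₁ a₁ b₁
      rw [h₂ (a₂ rfl) (b₂ rfl)]

theorem isMonomialOrder_degLex :
    IsMonomialOrder (DegLex : FreeMagma X → FreeMagma X → Prop) where
  strictTotal :=
    { trichotomous := fun _ _ => degLex_trichotomous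
      irrefl := degLex_irrefl
      trans := fun _ _ _ => degLex_trans }
  mul_right u v w h := by
    rw [degLex_mul_mul]
    rcases (length_le_of_degLex h).lt_or_eq with hl | hl
    · exact .inl (by omega)
    · exact .inr ⟨by omega, .inl h⟩
  mul_left u v w h := by
    rw [degLex_mul_mul]
    rcases (length_le_of_degLex h).lt_or_eq with hl | hl
    · exact .inl (by omega)
    · exact .inr ⟨by omega, .inr ⟨rfl, h⟩⟩

/-- Induction on length; among products of one length the order is lexicographic in the two factors,
which are shorter and hence already accessible. -/
theorem wellFounded_degLex [WellFoundedLT X] :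
    WellFounded (DegLex : FreeMagma X → FreeMagma X → Prop) := by
  refine ⟨fun u => ?_⟩
  induction hn : u.length using Nat.strong_induction_on generalizing u with
  | _ n ih =>
    induction u using FreeMagma.recOnMul with
    | ih1 i =>
      clear hn
      induction i using WellFoundedLT.induction with
      | _ i hi =>
        refine ⟨_, fun v hv => ?_⟩
        induction v using FreeMagma.recOnMul with
        | ih1 j => exact hi j (degLex_of_of.1 hv)
        | ih2 v₁ v₂ _ _ => exact absurd hv (not_degLex_mul_of _ _ _)
    | ih2 u₁ u₂ ih₁ ih₂ =>
      clear ih₁ ih₂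
      rw [length_mul] at hn
      have acc₁ : Acc DegLex u₁ := ih _ (by have := u₂.length_pos; omega) _ rfl
      -- When the first factor drops, the second one may change arbitrarily within the same total
      -- length.
      induction acc₁ generalizing u₂ with
      | intro u₁ _ h₁ =>
        have acc₂ : Acc DegLex u₂ := ih _ (by have := u₁.length_pos; omega) _ rfl
        induction acc₂ with
        | intro u₂ _ h₂ =>
          refine ⟨_, fun v hv => ?_⟩
          induction v using FreeMagma.recOnMul with
          | ih1 j =>
            refine ih _ ?_ _ rfl
            have := u₁.length_pos
            have := u₂.length_pos
            rw [length_of]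
            omega
          | ih2 v₁ v₂ _ _ =>
            rcases degLex_mul_mul.1 hv with hl | ⟨hl, h | ⟨rfl, h⟩⟩
            · exact ih _ (by rw [length_mul]; omega) _ rfl
            · exact h₁ v₁ h v₂ (by omega)
            · exact h₂ v₂ h (by omega)

end DegLexOrder

end NonassocGS

noncomputable section

namespace AkivisAlgebra

open NonassocGS

variable {k A I : Type*} [Field k] [AddCommGroup A] [Module k A]

theorem br_skew (P : AkivisAlgebra k A) (x y : A) : P.br x y = -P.br y x := by
  have h := P.br_self (x + y)
  simp only [map_add, LinearMap.add_apply, P.br_self, zero_add, add_zero] at h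
  exact eq_neg_of_add_eq_zero_right h

/-- Linearity is taken unbundled so that multilinear identities can be checked on basis vectors one
argument at a time. -/
theorem eq_zero_of_basis {N : Type*} [AddCommGroup N] [Module k N] (e : Module.Basis I k A)
    {F : A → N} (hadd : ∀ x y, F (x + y) = F x + F y) (hsmul : ∀ (c : k) x, F (c • x) = c • F x)
    (h : ∀ i, F (e i) = 0) (x : A) : F x = 0 :=
  LinearMap.congr_fun
    (e.ext (f₁ := IsLinearMap.mk' F ⟨hadd, hsmul⟩) (f₂ := 0) fun i => by simpa using h i) x

theorem lin_basis (e : Module.Basis I k A) (i : I) : lin e (e i) = letter k i := by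
  simp [lin]

/-! ### An algebra on `A × (I × I →₀ k)` that contains `A`

The second factor plays the role of the symmetric square of `A`: the vector attached to `(i, j)`
with `i ≤ j` stands for the symmetric product of `e i` and `e j`. -/

section Model

variable [LinearOrder I] (P : AkivisAlgebra k A) (e : Module.Basis I k A)

/-- A bilinear map on `A` with `halfBr x y - halfBr y x = [x,y]`. -/
def halfBr : A →ₗ[k] A →ₗ[k] A :=
  e.constr k fun i => e.constr k fun j => if j < i then P.br (e i) (e j) else 0

/-- The symmetric product of vectors of `A`. -/
def symProd (e : Module.Basis I k A) : A →ₗ[k] A →ₗ[k] (I × I →₀ k) :=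
  e.constr k fun i => e.constr k fun j => Finsupp.single (min i j, max i j) 1

theorem halfBr_basis (i j : I) :
    P.halfBr e (e i) (e j) = if j < i then P.br (e i) (e j) else 0 := by
  simp [halfBr]

theorem symProd_basis (i j : I) :
    symProd e (e i) (e j) = Finsupp.single (min i j, max i j) (1 : k) := by
  simp [symProd]

theorem halfBr_sub (x y : A) : P.halfBr e x y - P.halfBr e y x = P.br x y := by
  have h : P.halfBr e - (P.halfBr e).flip = P.br := by
    refine e.ext fun i => e.ext fun j => ?_
    simp only [LinearMap.sub_apply, LinearMap.flip_apply, halfBr_basis]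
    rcases lt_trichotomy i j with h | rfl | h
    · rw [if_neg h.asymm, if_pos h, P.br_skew (e i), zero_sub]
    · simp [P.br_self]
    · rw [if_neg h.asymm, if_pos h, sub_zero]
  exact LinearMap.congr_fun₂ h x y

theorem symProd_comm (x y : A) : symProd e x y = symProd e y x := by
  have h : symProd e = (symProd e).flip := by
    refine e.ext fun i => e.ext fun j => ?_
    rw [LinearMap.flip_apply, symProd_basis, symProd_basis, min_comm, max_comm]
  exact LinearMap.congr_fun₂ h x y

/-- The product of two vectors of `A` in the model. -/
def prodA : A →ₗ[k] A →ₗ[k] A × (I × I →₀ k) :=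
  LinearMap.mk₂ k (fun x y => (P.halfBr e x y, symProd e x y))
    (by simp) (by simp) (by simp) (by simp)

theorem prodA_apply (x y : A) : P.prodA e x y = (P.halfBr e x y, symProd e x y) := rfl

theorem prodA_sub (x y : A) : P.prodA e x y - P.prodA e y x = (P.br x y, 0) := by
  rw [prodA_apply, prodA_apply, Prod.mk_sub_mk, halfBr_sub, symProd_comm e x y, sub_self]

/-- The value that `(x ∘ y) z - x (y ∘ z)` must take in the model, where `∘` is the symmetric
product. -/
def defect (x y z : A) : A × (I × I →₀ k) :=
  (P.tri x y z, 0) + P.prodA e x (P.halfBr e y z) - P.prodA e (P.halfBr e x y) z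

theorem defect_add_left (x x' y z : A) :
    P.defect e (x + x') y z = P.defect e x y z + P.defect e x' y z := by
  -- Writing $(t,0)$ as the image of $t$ under a linear map makes every summand visibly linear.
  simp only [defect, ← LinearMap.inl_apply (R := k), map_add, LinearMap.add_apply]
  abel

theorem defect_add_mid (x y y' z : A) :
    P.defect e x (y + y') z = P.defect e x y z + P.defect e x y' z := by
  simp only [defect, ← LinearMap.inl_apply (R := k), map_add, LinearMap.add_apply]
  abel

theorem defect_add_right (x y z z' : A) :
    P.defect e x y (z + z') = P.defect e x y z + P.defect e x y z' := by
  simp only [defect, ← LinearMap.inl_apply (R := k), map_add]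
  abel

theorem defect_smul_left (c : k) (x y z : A) :
    P.defect e (c • x) y z = c • P.defect e x y z := by
  simp only [defect, ← LinearMap.inl_apply (R := k), map_smul, LinearMap.smul_apply, smul_sub,
    smul_add]

theorem defect_smul_mid (c : k) (x y z : A) :
    P.defect e x (c • y) z = c • P.defect e x y z := by
  simp only [defect, ← LinearMap.inl_apply (R := k), map_smul, LinearMap.smul_apply, smul_sub,
    smul_add]

theorem defect_smul_right (c : k) (x y z : A) :
    P.defect e x y (c • z) = c • P.defect e x y z := by
  simp only [defect, ← LinearMap.inl_apply (R := k), map_smul, smul_sub, smul_add]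

/-- The alternating sum of the trilinear products is the Jacobian. The remaining terms group into
commutators of a vector with a half bracket; antisymmetrizing turns these into double brackets that
cancel it. -/
theorem defect_alternating (x y z : A) :
    P.defect e x y z + P.defect e z x y + P.defect e y z x
      - P.defect e x z y - P.defect e y x z - P.defect e z y x = 0 := by
  have comm (x y z : A) : P.prodA e x (P.halfBr e y z) - P.prodA e (P.halfBr e y z) x
      - (P.prodA e x (P.halfBr e z y) - P.prodA e (P.halfBr e z y) x)
      = -((P.br (P.br y z) x, 0) : A × (I × I →₀ k)) := by
    rw [prodA_sub, prodA_sub, Prod.mk_sub_mk, ← map_sub, halfBr_sub, P.br_skew x]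
    simp
  have h₁ := comm x y z
  have h₂ := comm y z x
  have h₃ := comm z x y
  have hA : ((P.br (P.br x y) z + P.br (P.br y z) x + P.br (P.br z x) y, 0) : A × (I × I →₀ k)) =
      (P.tri x y z + P.tri z x y + P.tri y z x - P.tri x z y - P.tri y x z - P.tri z y x, 0) := by
    rw [P.akivis]
  have hA' : ((P.br (P.br x y) z, 0) : A × (I × I →₀ k)) + (P.br (P.br y z) x, 0)
        + (P.br (P.br z x) y, 0)
      = (P.tri x y z, 0) + (P.tri z x y, 0) + (P.tri y z x, 0) - (P.tri x z y, 0)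
        - (P.tri y x z, 0) - (P.tri z y x, 0) := by
    simpa using hA
  simp only [defect]
  linear_combination (norm := abel) h₁ + h₂ + h₃ - hA'

/-- The left action of the basis vector `e i` on the symmetric product of `e a` and `e b`. -/
def leftBasis (i a b : I) : A × (I × I →₀ k) :=
  -- Sorted triples $i\le a\le b$ go to zero, as does any $i\le a$. For $i>a$ and $a\le b$ the value
  -- is forced: subtracting the defect equations for $(a,i,b)$ and $(i,a,b)$ cancels the right
  -- actions, and the left action of $e_a$ on the product of $e_i$ and $e_b$ is zero.
  if i ≤ a then 0 else P.defect e (e a) (e i) (e b) - P.defect e (e i) (e a) (e b)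

/-- The right action of the basis vector `e l` on the symmetric product of `e a` and `e b`. -/
def rightBasis (a b l : I) : A × (I × I →₀ k) :=
  -- The defect equation for $(a,b,l)$ solved for the right action; only pairs with $a\le b$ occur
  -- as symmetric products.
  P.leftBasis e a (min b l) (max b l) + P.defect e (e a) (e b) (e l)

/-- For $i\le j$ this is how the right action was defined, and for $j<i$, $j\le l$ how the left
action was. Only $i>j>l$ is a genuine condition, and there it is the vanishing of the alternating
sum of defects. -/
theorem rightBasis_sub_leftBasis (i j l : I) :
    P.rightBasis e (min i j) (max i j) l - P.leftBasis e i (min j l) (max j l)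
      = P.defect e (e i) (e j) (e l) := by
  rcases le_or_gt i j with hij | hij
  · rw [min_eq_left hij, max_eq_right hij, rightBasis]
    abel
  · rw [min_eq_right hij.le, max_eq_left hij.le, rightBasis]
    rcases le_or_gt j l with hjl | hjl
    · rw [min_eq_left hjl, max_eq_right hjl, leftBasis, leftBasis, if_pos (le_min hij.le hjl),
        if_neg hij.not_ge]
      abel
    · have hil := hjl.trans hij
      rw [min_eq_right hjl.le, max_eq_left hjl.le, min_eq_right hil.le, max_eq_left hil.le,
        leftBasis, leftBasis, if_neg hjl.not_ge, if_neg hil.not_ge, ← sub_eq_zero,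
        ← neg_eq_zero, ← P.defect_alternating e (e i) (e j) (e l)]
      abel

/-- The left action of `A` on the second factor. -/
def leftAct : A →ₗ[k] (I × I →₀ k) →ₗ[k] A × (I × I →₀ k) :=
  e.constr k fun i => Finsupp.linearCombination k fun p => P.leftBasis e i p.1 p.2

/-- The right action of `A` on the second factor. -/
def rightAct : (I × I →₀ k) →ₗ[k] A →ₗ[k] A × (I × I →₀ k) :=
  Finsupp.linearCombination k fun p => e.constr k fun l => P.rightBasis e p.1 p.2 l

theorem rightAct_sub_leftAct (x y z : A) :
    P.rightAct e (symProd e x y) z - P.leftAct e x (symProd e y z) = P.defect e x y z := by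
  rw [← sub_eq_zero]
  refine eq_zero_of_basis e (F := fun x => P.rightAct e (symProd e x y) z
    - P.leftAct e x (symProd e y z) - P.defect e x y z) ?_ ?_ (fun i => ?_) x
  · intro x x'
    simp only [defect_add_left, map_add, LinearMap.add_apply]
    abel
  · intro c x
    simp only [defect_smul_left, map_smul, LinearMap.smul_apply, smul_sub]
  refine eq_zero_of_basis e (F := fun y => P.rightAct e (symProd e (e i) y) z
    - P.leftAct e (e i) (symProd e y z) - P.defect e (e i) y z) ?_ ?_ (fun j => ?_) y
  · intro y y'
    simp only [defect_add_mid, map_add, LinearMap.add_apply]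
    abel
  · intro c y
    simp only [defect_smul_mid, map_smul, LinearMap.smul_apply, smul_sub]
  refine eq_zero_of_basis e (F := fun z => P.rightAct e (symProd e (e i) (e j)) z
    - P.leftAct e (e i) (symProd e (e j) z) - P.defect e (e i) (e j) z) ?_ ?_ (fun l => ?_) z
  · intro z z'
    simp only [defect_add_right, map_add]
    abel
  · intro c z
    simp only [defect_smul_right, map_smul, smul_sub]
  rw [sub_eq_zero, ← rightBasis_sub_leftBasis]
  simp [rightAct, leftAct, symProd_basis]

/-- The vector space `A × (I × I →₀ k)` as a non-associative algebra. -/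
@[nolint unusedArguments]
def Model (_ : AkivisAlgebra k A) (_ : Module.Basis I k A) : Type _ := A × (I × I →₀ k)

namespace Model

instance : AddCommGroup (Model P e) := inferInstanceAs (AddCommGroup (A × (I × I →₀ k)))

instance : Module k (Model P e) := inferInstanceAs (Module k (A × (I × I →₀ k)))

/-- The multiplication of the model. -/
def mulMap : Model P e →ₗ[k] Model P e →ₗ[k] Model P e :=
  LinearMap.mk₂ k (M := A × (I × I →₀ k)) (Nₗ := A × (I × I →₀ k)) (Pₗ := A × (I × I →₀ k))
    -- Two elements of the second factor multiply to zero; associators of vectors of $A$ never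
    -- involve such a product.
    (fun u v => P.prodA e u.1 v.1 + P.leftAct e u.1 v.2 + P.rightAct e u.2 v.1)
    (fun u u' v => by simp only [Prod.fst_add, Prod.snd_add, map_add, LinearMap.add_apply]; abel)
    (fun c u v => by
      simp only [Prod.smul_fst, Prod.smul_snd, map_smul, LinearMap.smul_apply, smul_add])
    (fun u v v' => by simp only [Prod.fst_add, Prod.snd_add, map_add]; abel)
    (fun c u v => by simp only [Prod.smul_fst, Prod.smul_snd, map_smul, smul_add])

instance : NonUnitalNonAssocRing (Model P e) :=
  { (inferInstance : AddCommGroup (Model P e)) with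
    mul := fun u v => mulMap P e u v
    left_distrib := fun u v w => map_add (mulMap P e u) v w
    right_distrib := fun u v w => LinearMap.map_add₂ (mulMap P e) u v w
    zero_mul := fun u => LinearMap.map_zero₂ (mulMap P e) u
    mul_zero := fun u => map_zero (mulMap P e u) }

instance : IsScalarTower k (Model P e) (Model P e) where
  smul_assoc c u v := LinearMap.map_smul₂ (mulMap P e) c u v

instance : SMulCommClass k (Model P e) (Model P e) where
  smul_comm c u v := (map_smul (mulMap P e u) c v).symm

/-- The inclusion of `A` into the model. -/
def incl : A →ₗ[k] Model P e := LinearMap.inl k A (I × I →₀ k)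

theorem incl_injective : Function.Injective (incl P e) := LinearMap.inl_injective

theorem mul_def (u v : A × (I × I →₀ k)) :
    (show Model P e from u) * (show Model P e from v) =
      P.prodA e u.1 v.1 + P.leftAct e u.1 v.2 + P.rightAct e u.2 v.1 := rfl

theorem incl_mul_incl (x y : A) : incl P e x * incl P e y = P.prodA e x y := by
  refine (mul_def P e (x, 0) (y, 0)).trans ?_
  simp
  rfl

theorem incl_br (x y : A) :
    incl P e x * incl P e y - incl P e y * incl P e x = incl P e (P.br x y) := by
  rw [incl_mul_incl, incl_mul_incl]
  exact P.prodA_sub e x y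

theorem incl_tri (x y z : A) :
    incl P e x * incl P e y * incl P e z - incl P e x * (incl P e y * incl P e z)
      = incl P e (P.tri x y z) := by
  have h₁ : incl P e x * incl P e y * incl P e z =
      P.prodA e (P.halfBr e x y) z + P.rightAct e (symProd e x y) z := by
    rw [incl_mul_incl]
    refine (mul_def P e (P.prodA e x y) (z, 0)).trans ?_
    simp [prodA_apply]
    rfl
  have h₂ : incl P e x * (incl P e y * incl P e z) =
      P.prodA e x (P.halfBr e y z) + P.leftAct e x (symProd e y z) := by
    rw [incl_mul_incl]
    refine (mul_def P e (x, 0) (P.prodA e y z)).trans ?_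
    simp [prodA_apply]
    rfl
  have h₃ := P.rightAct_sub_leftAct e x y z
  rw [defect] at h₃
  rw [h₁, h₂]
  change P.prodA e (P.halfBr e x y) z + P.rightAct e (symProd e x y) z
    - (P.prodA e x (P.halfBr e y z) + P.leftAct e x (symProd e y z)) = (P.tri x y z, 0)
  linear_combination (norm := abel) h₃

/-- The homomorphism `M({e_i}) → Model` that extends the inclusion of `A`. -/
def lift : Free k I →ₙₐ[k] Model P e :=
  FreeNonUnitalNonAssocAlgebra.lift k fun i => incl P e (e i)

theorem lift_lin (x : A) : lift P e (lin e x) = incl P e x := by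
  have h : ((lift P e : Free k I →ₗ[k] Model P e)) ∘ₗ lin e = incl P e :=
    e.ext fun i => by
      rw [LinearMap.comp_apply, lin_basis]
      exact FreeNonUnitalNonAssocAlgebra.lift_of_apply k _ i
  exact LinearMap.congr_fun h x

theorem lift_letter (i : I) : lift P e (letter k i) = incl P e (e i) :=
  FreeNonUnitalNonAssocAlgebra.lift_of_apply k _ i

theorem lift_eq_zero_of_mem {f : Free k I} (hf : f ∈ idealSpan k (P.envRel e)) :
    lift P e f = 0 := by
  refine (Submodule.mem_sInf.1 hf) (LinearMap.ker (lift P e : Free k I →ₗ[k] Model P e)) ⟨?_, ?_⟩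
  · rintro _ (⟨i, j, rfl⟩ | ⟨i, j, l, rfl⟩)
    · change lift P e _ = 0
      rw [commRel, brPoly, map_sub, map_sub, map_mul, map_mul, lift_letter, lift_letter, lift_lin,
        incl_br, sub_self]
    · change lift P e _ = 0
      rw [assocRel, triPoly, map_sub, map_sub, map_mul, map_mul, map_mul, map_mul, lift_letter,
        lift_letter, lift_letter, lift_lin, incl_tri, sub_self]
  · intro a x hx
    replace hx : lift P e x = 0 := hx
    refine ⟨show lift P e _ = 0 from ?_, show lift P e _ = 0 from ?_⟩
    · rw [map_mul, hx, mul_zero]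
    · rw [map_mul, hx, zero_mul]

end Model

/-- The map `Model.lift` kills the relations and restricts to the injective inclusion on linear
polynomials. -/
theorem toEnv_injective : Function.Injective (P.toEnv e) := by
  rw [injective_iff_map_eq_zero]
  intro x hx
  have h : lin e x ∈ idealSpan k (P.envRel e) := (Submodule.Quotient.mk_eq_zero _).1 hx
  have h' := Model.lift_eq_zero_of_mem P e h
  rw [Model.lift_lin] at h'
  exact (injective_iff_map_eq_zero _).1 (Model.incl_injective P e) x h'

end Model

end AkivisAlgebra

end

noncomputable section

namespace NonassocGS

/-! ### Generated ideals, leading words and trivial polynomials -/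

section LeadingWords

variable {k X : Type*} [Field k]

theorem subset_idealSpan {M : Type*} [NonUnitalNonAssocRing M] [Module k M] (S : Set M) :
    S ⊆ idealSpan k S := fun _ hx => Submodule.mem_sInf.2 fun _ hJ => hJ.1 hx

theorem idealSpan_le_iff {M : Type*} [NonUnitalNonAssocRing M] [Module k M] {S T : Set M} :
    idealSpan k S ≤ idealSpan k T ↔ S ⊆ idealSpan k T :=
  ⟨fun h => (subset_idealSpan S).trans h,
    fun h => sInf_le ⟨h, fun a _ hx => mul_mem_idealSpan T a hx⟩⟩

/-- The polynomials all of whose words are smaller than `w`. -/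
def below (k : Type*) [Field k] (lt : FreeMagma X → FreeMagma X → Prop) (w : FreeMagma X) :
    Submodule k (Free k X) :=
  (Finsupp.supported k k {v | lt v w}).comap (MonoidAlgebra.coeffLinearEquiv k).toLinearMap

theorem mem_below {lt : FreeMagma X → FreeMagma X → Prop} {w : FreeMagma X} {f : Free k X} :
    f ∈ below k lt w ↔ ∀ v ∈ f.coeff.support, lt v w := Iff.rfl

theorem single_mem_below {lt : FreeMagma X → FreeMagma X → Prop} {v w : FreeMagma X}
    (h : lt v w) : (MonoidAlgebra.single v 1 : Free k X) ∈ below k lt w := by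
  rw [mem_below]
  intro u hu
  rw [MonoidAlgebra.coeff_single] at hu
  obtain rfl := Finset.mem_singleton.1 (Finsupp.support_single_subset hu)
  exact h

variable {lt : FreeMagma X → FreeMagma X → Prop}

/-- The hypothesis says "monic with leading word $w$" as membership in a subspace, so it can be
verified summand by summand. A coefficient other than $1$ would put $w$ itself among the words below
$w$. -/
theorem coeff_eq_one_of_sub_mem_below (h : IsMonomialOrder lt) {f : Free k X} {w : FreeMagma X}
    (hf : f - MonoidAlgebra.single w 1 ∈ below k lt w) : f.coeff w = 1 := by
  have := h.strictTotal
  by_contra hc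
  refine irrefl_of lt w (mem_below.1 hf w ?_)
  simpa [sub_eq_zero] using hc

theorem isLeadingWord_of_sub_mem_below (h : IsMonomialOrder lt) {f : Free k X} {w : FreeMagma X}
    (hf : f - MonoidAlgebra.single w 1 ∈ below k lt w) : IsLeadingWord lt f w := by
  refine ⟨?_, fun v hv hne => mem_below.1 hf v ?_⟩
  · rw [Finsupp.mem_support_iff, coeff_eq_one_of_sub_mem_below h hf]
    exact one_ne_zero
  · simpa [hne.symm, Finsupp.single_apply] using hv

theorem IsLeadingWord.unique (h : IsMonomialOrder lt) {f : Free k X} {v w : FreeMagma X}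
    (hv : IsLeadingWord lt f v) (hw : IsLeadingWord lt f w) : v = w := by
  have := h.strictTotal
  by_contra hne
  exact asymm_of lt (hw.2 v hv.1 hne) (hv.2 w hw.1 (Ne.symm hne))

/-- The span of the `S`-words that are smaller than `w`. -/
def trivialSpan (lt : FreeMagma X → FreeMagma X → Prop) (S : Set (Free k X)) (w : FreeMagma X) :
    Submodule k (Free k X) :=
  Submodule.span k
    {h | ∃ s ∈ S, ∃ v, IsLeadingWord lt s v ∧ ∃ c : Context X, lt (c.word v) w ∧ h = c.poly s}

theorem poly_mem_trivialSpan {S : Set (Free k X)} {w v : FreeMagma X} {s : Free k X} (hs : s ∈ S)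
    (hv : IsLeadingWord lt s v) (c : Context X) (hc : lt (c.word v) w) :
    c.poly s ∈ trivialSpan lt S w :=
  Submodule.subset_span ⟨s, hs, v, hv, c, hc, rfl⟩

end LeadingWords

end NonassocGS

namespace AkivisAlgebra

open NonassocGS

/-! ### The ideal of $S$ and the canonical homomorphism -/

section Relations

variable {k A I : Type*} [Field k] [AddCommGroup A] [Module k A]
  (P : AkivisAlgebra k A) (e : Module.Basis I k A)

theorem commRel_self (i : I) : P.commRel e i i = 0 := by
  simp [commRel, brPoly, P.br_self]

theorem commRel_swap (i j : I) : P.commRel e i j = -P.commRel e j i := by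
  simp only [commRel, brPoly, P.br_skew (e i), map_neg]
  abel

/-- This serves twice: it puts the third family into the ideal of the defining relations, and it
rewrites the composition of the first two families. -/
theorem derivedRel_eq (i j l : I) :
    P.derivedRel e i j l =
      P.assocRel e j i l - P.assocRel e i j l + P.commRel e i j * letter k l := by
  simp only [derivedRel, assocRel, commRel, sub_mul]
  abel

theorem commRel_mem_idealSpan_envRel (i j : I) :
    P.commRel e i j ∈ idealSpan k (P.envRel e) :=
  subset_idealSpan _ (.inl ⟨i, j, rfl⟩)

theorem assocRel_mem_idealSpan_envRel (i j l : I) :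
    P.assocRel e i j l ∈ idealSpan k (P.envRel e) :=
  subset_idealSpan _ (.inr ⟨i, j, l, rfl⟩)

theorem idealSpan_gsSet [LinearOrder I] :
    idealSpan k (P.gsSet e) = idealSpan k (P.envRel e) := by
  apply le_antisymm <;> rw [idealSpan_le_iff]
  · rintro _ ((⟨i, j, -, rfl⟩ | ⟨i, j, l, rfl⟩) | ⟨i, j, l, -, -, rfl⟩)
    · exact P.commRel_mem_idealSpan_envRel e i j
    · exact P.assocRel_mem_idealSpan_envRel e i j l
    · rw [derivedRel_eq]
      exact add_mem (sub_mem (P.assocRel_mem_idealSpan_envRel e j i l)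
        (P.assocRel_mem_idealSpan_envRel e i j l))
        (mul_mem_idealSpan _ _ (P.commRel_mem_idealSpan_envRel e i j)).2
  · rintro _ (⟨i, j, rfl⟩ | ⟨i, j, l, rfl⟩)
    · rcases lt_trichotomy i j with h | rfl | h
      · rw [commRel_swap]
        exact neg_mem (subset_idealSpan _ (.inl (.inl ⟨j, i, h, rfl⟩)))
      · rw [commRel_self]
        exact zero_mem _
      · exact subset_idealSpan _ (.inl (.inl ⟨i, j, h, rfl⟩))
    · exact subset_idealSpan _ (.inl (.inr ⟨i, j, l, rfl⟩))

theorem ofAlgebra_br {B : Type*} [NonUnitalNonAssocRing B] [Module k B] [IsScalarTower k B B]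
    [SMulCommClass k B B] (x y : B) : (ofAlgebra k B).br x y = x * y - y * x := rfl

theorem ofAlgebra_tri {B : Type*} [NonUnitalNonAssocRing B] [Module k B] [IsScalarTower k B B]
    [SMulCommClass k B B] (x y z : B) : (ofAlgebra k B).tri x y z = x * y * z - x * (y * z) := rfl

theorem toEnv_basis (i : I) : P.toEnv e (e i) = Presented.mk (P.envRel e) (letter k i) := by
  rw [toEnv, LinearMap.comp_apply, lin_basis]

theorem isHom_toEnv : IsHom P (ofAlgebra k (P.Env e)) (P.toEnv e) := by
  constructor
  · have h : P.br.compr₂ (P.toEnv e) =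
        (ofAlgebra k (P.Env e)).br.compl₁₂ (P.toEnv e) (P.toEnv e) := by
      refine e.ext fun i => e.ext fun j => ?_
      rw [LinearMap.compr₂_apply, LinearMap.compl₁₂_apply, ofAlgebra_br, toEnv_basis, toEnv_basis,
        ← Presented.mk_mul, ← Presented.mk_mul, ← map_sub]
      refine ((Presented.mk_eq_mk _).2 ?_).symm
      exact P.commRel_mem_idealSpan_envRel e i j
    exact LinearMap.congr_fun₂ h
  · intro x y z
    rw [← sub_eq_zero]
    set Q := ofAlgebra k (P.Env e)
    refine eq_zero_of_basis e (F := fun x => P.toEnv e (P.tri x y z)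
      - Q.tri (P.toEnv e x) (P.toEnv e y) (P.toEnv e z)) ?_ ?_ (fun i => ?_) x
    · intro x x'
      simp only [map_add, LinearMap.add_apply]
      abel
    · intro c x
      simp only [map_smul, LinearMap.smul_apply, smul_sub]
    refine eq_zero_of_basis e (F := fun y => P.toEnv e (P.tri (e i) y z)
      - Q.tri (P.toEnv e (e i)) (P.toEnv e y) (P.toEnv e z)) ?_ ?_ (fun j => ?_) y
    · intro x x'
      simp only [map_add, LinearMap.add_apply]
      abel
    · intro c x
      simp only [map_smul, LinearMap.smul_apply, smul_sub]
    refine eq_zero_of_basis e (F := fun z => P.toEnv e (P.tri (e i) (e j) z)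
      - Q.tri (P.toEnv e (e i)) (P.toEnv e (e j)) (P.toEnv e z)) ?_ ?_ (fun l => ?_) z
    · intro x x'
      simp only [map_add]
      abel
    · intro c x
      simp only [map_smul, smul_sub]
    rw [sub_eq_zero, ofAlgebra_tri, toEnv_basis, toEnv_basis, toEnv_basis,
      ← Presented.mk_mul, ← Presented.mk_mul, ← Presented.mk_mul, ← Presented.mk_mul, ← map_sub]
    refine ((Presented.mk_eq_mk _).2 ?_).symm
    exact P.assocRel_mem_idealSpan_envRel e i j l

end Relations

/-! ### Leading words and compositions of $S$ -/

section GroebnerShirshov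

open FreeMagma (of)

variable {k A I : Type*} [Field k] [AddCommGroup A] [Module k A]
  (P : AkivisAlgebra k A) (e : Module.Basis I k A)

theorem letter_eq_single (i : I) : letter k i = MonoidAlgebra.single (of i) 1 := rfl

theorem lin_mem_of_letter_mem {J : Submodule k (Free k I)} (h : ∀ i, letter k i ∈ J) (x : A) :
    lin e x ∈ J :=
  (Submodule.span_le.2 (Set.range_subset_iff.2 h))
    ((Finsupp.range_linearCombination k (v := letter k)).le ⟨e.repr x, rfl⟩)

theorem lin_mul_letter_mem {J : Submodule k (Free k I)} (l : I)
    (h : ∀ i, letter k i * letter k l ∈ J) (x : A) : lin e x * letter k l ∈ J :=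
  lin_mem_of_letter_mem e (J := J.comap (LinearMap.mulRight k (letter k l))) h x

theorem letter_mul_letter (i j : I) :
    letter k i * letter k j = MonoidAlgebra.single (of i * of j) 1 := by
  simp only [letter_eq_single, MonoidAlgebra.single_mul_single, mul_one]

theorem letter_mul_letter_mul_letter (i j l : I) :
    letter k i * (letter k j * letter k l) = MonoidAlgebra.single (of i * (of j * of l)) 1 := by
  simp only [letter_eq_single, MonoidAlgebra.single_mul_single, mul_one]

theorem letter_mul_letter_mul_letter' (i j l : I) :
    letter k i * letter k j * letter k l = MonoidAlgebra.single (of i * of j * of l) 1 := by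
  simp only [letter_eq_single, MonoidAlgebra.single_mul_single, mul_one]

/-- Two ways of sorting meet: $e_i(e_je_l)\to e_i(e_le_j)\to e_l(e_ie_j)\to e_l(e_je_i)$ and
$e_j(e_ie_l)\to e_j(e_le_i)\to e_l(e_je_i)$. The quadratic leftovers become commutators with linear
polynomials, and the linear ones cancel by the Akivis identity. -/
theorem derivedRel_expansion (i j l : I) :
    P.derivedRel e i j l =
      letter k i * P.commRel e j l - letter k j * P.commRel e i l + letter k l * P.commRel e i j
      + P.derivedRel e i l j - P.derivedRel e j l i
      + (letter k i * lin e (P.br (e j) (e l)) - lin e (P.br (e j) (e l)) * letter k i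
          - lin e (P.br (e i) (P.br (e j) (e l))))
      - (letter k j * lin e (P.br (e i) (e l)) - lin e (P.br (e i) (e l)) * letter k j
          - lin e (P.br (e j) (P.br (e i) (e l))))
      + (letter k l * lin e (P.br (e i) (e j)) - lin e (P.br (e i) (e j)) * letter k l
          - lin e (P.br (e l) (P.br (e i) (e j)))) := by
  have h := congrArg (lin e) (P.akivis (e i) (e j) (e l))
  -- The double brackets are turned to the shape $[x,[y,z]]$ in which the commutator terms produce
  -- them.
  rw [P.br_skew (P.br (e i) (e j)), P.br_skew (P.br (e j) (e l)), P.br_skew (P.br (e l) (e i)),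
    P.br_skew (e l) (e i)] at h
  simp only [map_add, map_sub, map_neg] at h
  simp only [derivedRel, commRel, brPoly, triPoly, mul_sub]
  linear_combination (norm := abel) -h

theorem of_inj {i j : I} : of i = of j ↔ i = j :=
  ⟨fun h => by cases h; rfl, fun h => by rw [h]⟩

theorem mul_eq_mul_iff {u₁ u₂ v₁ v₂ : FreeMagma I} : u₁ * u₂ = v₁ * v₂ ↔ u₁ = v₁ ∧ u₂ = v₂ :=
  ⟨fun h => by cases h; exact ⟨rfl, rfl⟩, fun h => by rw [h.1, h.2]⟩

theorem of_ne_mul (i : I) (u v : FreeMagma I) : of i ≠ u * v := fun h => nomatch h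

/-- A letter has no proper subwords. -/
theorem word_eq_of {c : Context I} {v : FreeMagma I} {i : I} (h : of i = c.word v) : v = of i := by
  cases c with
  | hole => exact h.symm
  | left w c => exact absurd h (of_ne_mul _ _ _)
  | right c w => exact absurd h (of_ne_mul _ _ _)

/-- The subwords of a product are the product and the subwords of its factors. -/
theorem word_eq_mul {c : Context I} {v u₁ u₂ : FreeMagma I} (h : u₁ * u₂ = c.word v) :
    (c = .hole ∧ v = u₁ * u₂) ∨ (∃ c', c = .left u₁ c' ∧ u₂ = c'.word v) ∨
      ∃ c', c = .right c' u₂ ∧ u₁ = c'.word v := by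
  cases c with
  | hole => exact .inl ⟨rfl, h.symm⟩
  | left w c =>
    obtain ⟨rfl, hc⟩ := (mul_eq_mul_iff (v₂ := c.word v)).1 h
    exact .inr (.inl ⟨c, rfl, hc⟩)
  | right c w =>
    obtain ⟨hc, rfl⟩ := (mul_eq_mul_iff (v₁ := c.word v)).1 h
    exact .inr (.inr ⟨c, rfl, hc⟩)

variable [LinearOrder I]

theorem lin_mem_below (x : A) {w : FreeMagma I} (hw : 1 < w.length) :
    lin e x ∈ below k DegLex w :=
  lin_mem_of_letter_mem e (fun _ => single_mem_below (degLex_of_length_lt hw)) x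

theorem commRel_sub_mem_below {i j : I} (h : j < i) :
    P.commRel e i j - MonoidAlgebra.single (of i * of j) 1 ∈ below k DegLex (of i * of j) := by
  have h₁ : letter k j * letter k i ∈ below k DegLex (of i * of j) := by
    rw [letter_mul_letter]
    exact single_mem_below (degLex_mul_mul.2 (.inr ⟨rfl, .inl (degLex_of_of.2 h)⟩))
  have h₂ : P.brPoly e i j ∈ below k DegLex (of i * of j) :=
    lin_mem_below e _ (by simp only [length_mul, length_of]; norm_num)
  rw [← letter_mul_letter]
  convert neg_mem (add_mem h₁ h₂) using 1
  rw [commRel]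
  abel

theorem assocRel_sub_mem_below (i j l : I) :
    P.assocRel e i j l - MonoidAlgebra.single (of i * of j * of l) 1
      ∈ below k DegLex (of i * of j * of l) := by
  have h₁ : letter k i * (letter k j * letter k l) ∈ below k DegLex (of i * of j * of l) := by
    rw [letter_mul_letter_mul_letter]
    exact single_mem_below (degLex_mul_mul.2 (.inr ⟨rfl, .inl (degLex_of_mul _ _ _)⟩))
  have h₂ : P.triPoly e i j l ∈ below k DegLex (of i * of j * of l) :=
    lin_mem_below e _ (by simp only [length_mul, length_of]; norm_num)
  rw [← letter_mul_letter_mul_letter']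
  convert neg_mem (add_mem h₁ h₂) using 1
  rw [assocRel]
  abel

theorem derivedRel_sub_mem_below {i j : I} (h : j < i) (l : I) :
    P.derivedRel e i j l - MonoidAlgebra.single (of i * (of j * of l)) 1
      ∈ below k DegLex (of i * (of j * of l)) := by
  have hl : 2 < (of i * (of j * of l)).length := by
    simp only [length_mul, length_of]; norm_num
  have h₁ : letter k j * (letter k i * letter k l) ∈ below k DegLex (of i * (of j * of l)) := by
    rw [letter_mul_letter_mul_letter]
    exact single_mem_below (degLex_mul_mul.2 (.inr ⟨rfl, .inl (degLex_of_of.2 h)⟩))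
  have h₂ : P.brPoly e i j * letter k l ∈ below k DegLex (of i * (of j * of l)) := by
    refine lin_mul_letter_mem e l (fun m => ?_) _
    rw [letter_mul_letter]
    exact single_mem_below (degLex_of_length_lt hl)
  have h₃ : P.triPoly e j i l ∈ below k DegLex (of i * (of j * of l)) :=
    lin_mem_below e _ (by omega)
  have h₄ : P.triPoly e i j l ∈ below k DegLex (of i * (of j * of l)) :=
    lin_mem_below e _ (by omega)
  rw [← letter_mul_letter_mul_letter]
  convert add_mem (neg_mem (add_mem (add_mem h₁ h₂) h₃)) h₄ using 1
  rw [derivedRel]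
  abel

theorem isLeadingWord_commRel {i j : I} (h : j < i) :
    IsLeadingWord DegLex (P.commRel e i j) (of i * of j) :=
  isLeadingWord_of_sub_mem_below isMonomialOrder_degLex (P.commRel_sub_mem_below e h)

theorem isLeadingWord_assocRel (i j l : I) :
    IsLeadingWord DegLex (P.assocRel e i j l) (of i * of j * of l) :=
  isLeadingWord_of_sub_mem_below isMonomialOrder_degLex (P.assocRel_sub_mem_below e i j l)

theorem isLeadingWord_derivedRel {i j : I} (h : j < i) (l : I) :
    IsLeadingWord DegLex (P.derivedRel e i j l) (of i * (of j * of l)) :=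
  isLeadingWord_of_sub_mem_below isMonomialOrder_degLex (P.derivedRel_sub_mem_below e h l)

/-! ### Triviality of the compositions -/

section Trivial

variable {w : FreeMagma I}

theorem commRel_mem_trivialSpan (hw : 2 < w.length) (i j : I) :
    P.commRel e i j ∈ trivialSpan DegLex (P.gsSet e) w := by
  have key {i j : I} (h : j < i) : P.commRel e i j ∈ trivialSpan DegLex (P.gsSet e) w :=
    poly_mem_trivialSpan (.inl (.inl ⟨i, j, h, rfl⟩)) (P.isLeadingWord_commRel e h) .hole
      (degLex_of_length_lt hw)
  rcases lt_trichotomy i j with h | rfl | h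
  · rw [commRel_swap]
    exact neg_mem (key h)
  · rw [commRel_self]
    exact zero_mem _
  · exact key h

/-- The commutation relation holds for all linear polynomials, not only for letters. -/
theorem lin_commutator_mem_trivialSpan (hw : 2 < w.length) (i : I) (x : A) :
    letter k i * lin e x - lin e x * letter k i - lin e (P.br (e i) x)
      ∈ trivialSpan DegLex (P.gsSet e) w := by
  rw [← Submodule.Quotient.mk_eq_zero]
  refine eq_zero_of_basis (N := Free k I ⧸ trivialSpan DegLex (P.gsSet e) w) e
    (F := fun x => Submodule.Quotient.mk
      (letter k i * lin e x - lin e x * letter k i - lin e (P.br (e i) x))) ?_ ?_ (fun j => ?_) x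
  · intro x y
    rw [← Submodule.Quotient.mk_add]
    simp only [map_add, mul_add, add_mul]
    congr 1
    abel
  · intro c x
    rw [← Submodule.Quotient.mk_smul]
    simp only [map_smul, mul_smul_comm, smul_mul_assoc, smul_sub]
  · rw [Submodule.Quotient.mk_eq_zero, lin_basis]
    exact P.commRel_mem_trivialSpan e hw i j

/-- No condition links the letters: at equal length, a word whose first factor is a letter is below
one whose first factor is a product. -/
theorem letter_mul_commRel_mem_trivialSpan (a b c i j l : I) :
    letter k a * P.commRel e b c ∈ trivialSpan DegLex (P.gsSet e) (of i * of j * of l) := by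
  have key {b c : I} (h : c < b) :
      letter k a * P.commRel e b c ∈ trivialSpan DegLex (P.gsSet e) (of i * of j * of l) :=
    poly_mem_trivialSpan (.inl (.inl ⟨b, c, h, rfl⟩)) (P.isLeadingWord_commRel e h)
      (.left (of a) .hole)
      (degLex_mul_mul.2 (.inr ⟨rfl, .inl (degLex_of_mul _ _ _)⟩))
  rcases lt_trichotomy b c with h | rfl | h
  · rw [commRel_swap, mul_neg]
    exact neg_mem (key h)
  · rw [commRel_self, mul_zero]
    exact zero_mem _
  · exact key h

theorem derivedRel_mem_trivialSpan_of_le {a b c : I} (hab : b < a) (hbc : b ≤ c) (i j l : I) :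
    P.derivedRel e a b c ∈ trivialSpan DegLex (P.gsSet e) (of i * of j * of l) :=
  poly_mem_trivialSpan (.inr ⟨a, b, c, hab, hbc, rfl⟩) (P.isLeadingWord_derivedRel e hab c) .hole
    (degLex_mul_mul.2 (.inr ⟨rfl, .inl (degLex_of_mul _ _ _)⟩))

/-- For $l<j$ the polynomial is not in $S$, but the two of its kind in the expansion, for $(i,l,j)$
and $(j,l,i)$, are. -/
theorem derivedRel_mem_trivialSpan {i j : I} (hij : j < i) (l : I) :
    P.derivedRel e i j l ∈ trivialSpan DegLex (P.gsSet e) (of i * of j * of l) := by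
  rcases le_or_gt j l with hjl | hjl
  · exact P.derivedRel_mem_trivialSpan_of_le e hij hjl i j l
  · have hw : 2 < (of i * of j * of l).length := by simp only [length_mul, length_of]; norm_num
    rw [derivedRel_expansion]
    refine add_mem (sub_mem (add_mem (sub_mem (add_mem (add_mem (sub_mem ?_ ?_) ?_) ?_) ?_)
      ?_) ?_) ?_
    · exact P.letter_mul_commRel_mem_trivialSpan e i j l i j l
    · exact P.letter_mul_commRel_mem_trivialSpan e j i l i j l
    · exact P.letter_mul_commRel_mem_trivialSpan e l i j i j l
    · exact P.derivedRel_mem_trivialSpan_of_le e (hjl.trans hij) hjl.le i j l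
    · exact P.derivedRel_mem_trivialSpan_of_le e hjl (hjl.trans hij).le i j l
    · exact P.lin_commutator_mem_trivialSpan e hw i _
    · exact P.lin_commutator_mem_trivialSpan e hw j _
    · exact P.lin_commutator_mem_trivialSpan e hw l _

theorem assocRel_composition_mem_trivialSpan {i j : I} (hij : j < i) (l : I) :
    P.assocRel e i j l - P.commRel e i j * letter k l
      ∈ trivialSpan DegLex (P.gsSet e) (of i * of j * of l) := by
  have h₁ : P.assocRel e j i l ∈ trivialSpan DegLex (P.gsSet e) (of i * of j * of l) :=
    poly_mem_trivialSpan (.inl (.inr ⟨j, i, l, rfl⟩)) (P.isLeadingWord_assocRel e j i l) .hole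
      (degLex_mul_mul.2 (.inr ⟨rfl, .inl
        (degLex_mul_mul.2 (.inr ⟨rfl, .inl (degLex_of_of.2 hij)⟩))⟩))
  convert sub_mem h₁ (P.derivedRel_mem_trivialSpan e hij l) using 1
  rw [derivedRel_eq]
  abel

end Trivial

/-- The elements of `S` together with their leading words. -/
inductive IsRelWord (P : AkivisAlgebra k A) (e : Module.Basis I k A) :
    Free k I → FreeMagma I → Prop
  | comm {i j : I} (h : j < i) : IsRelWord P e (P.commRel e i j) (of i * of j)
  | assoc (i j l : I) : IsRelWord P e (P.assocRel e i j l) (of i * of j * of l)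
  | derived {i j l : I} (h : j < i) (hl : j ≤ l) :
    IsRelWord P e (P.derivedRel e i j l) (of i * (of j * of l))

theorem exists_isRelWord {f : Free k I} (hf : f ∈ P.gsSet e) :
    ∃ w, IsRelWord P e f w ∧ IsLeadingWord DegLex f w ∧ f.coeff w = 1 := by
  rcases hf with (⟨i, j, h, rfl⟩ | ⟨i, j, l, rfl⟩) | ⟨i, j, l, h, hl, rfl⟩
  · exact ⟨_, .comm h, P.isLeadingWord_commRel e h,
      coeff_eq_one_of_sub_mem_below isMonomialOrder_degLex (P.commRel_sub_mem_below e h)⟩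
  · exact ⟨_, .assoc i j l, P.isLeadingWord_assocRel e i j l,
      coeff_eq_one_of_sub_mem_below isMonomialOrder_degLex (P.assocRel_sub_mem_below e i j l)⟩
  · exact ⟨_, .derived h hl, P.isLeadingWord_derivedRel e h l,
      coeff_eq_one_of_sub_mem_below isMonomialOrder_degLex (P.derivedRel_sub_mem_below e h l)⟩

theorem isRelWord_of_isLeadingWord {f : Free k I} (hf : f ∈ P.gsSet e) {w : FreeMagma I}
    (hw : IsLeadingWord DegLex f w) : IsRelWord P e f w := by
  obtain ⟨v, hv, hv', -⟩ := P.exists_isRelWord e hf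
  rwa [hw.unique isMonomialOrder_degLex hv']

variable {P e} in
theorem IsRelWord.ne_of {f : Free k I} {w : FreeMagma I} (h : IsRelWord P e f w) (i : I) :
    w ≠ of i := by
  cases h <;> exact (of_ne_mul _ _ _).symm

variable {P e} in
/-- A leading word of an element of `S` determines the element. -/
theorem IsRelWord.unique {f g : Free k I} {w v : FreeMagma I} (hf : IsRelWord P e f w)
    (hg : IsRelWord P e g v) (h : v = w) : f = g := by
  -- The three families have leading words of different shapes, so only the diagonal cases survive.
  cases hf <;> cases hg <;>
    simp only [mul_eq_mul_iff, of_inj, of_ne_mul, (of_ne_mul _ _ _).symm, and_false,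
      false_and] at h
  · obtain ⟨rfl, rfl⟩ := h
    rfl
  · obtain ⟨⟨rfl, rfl⟩, rfl⟩ := h
    rfl
  · obtain ⟨rfl, rfl, rfl⟩ := h
    rfl

theorem isGroebnerShirshovBasis_gsSet : IsGroebnerShirshovBasis DegLex (P.gsSet e) where
  monomialOrder := isMonomialOrder_degLex
  monic s hs := by
    obtain ⟨w, -, h⟩ := P.exists_isRelWord e hs
    exact ⟨w, h⟩
  trivial f hf g hg w v hw hv c hc := by
    replace hw := P.isRelWord_of_isLeadingWord e hf hw
    replace hv := P.isRelWord_of_isLeadingWord e hg hv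
    have not_letter {i : I} {c : Context I} : of i ≠ c.word v :=
      fun h => hv.ne_of i (word_eq_of h)
    change f - c.poly g ∈ trivialSpan DegLex (P.gsSet e) w
    have same (h : c = .hole ∧ v = w) : f - c.poly g ∈ trivialSpan DegLex (P.gsSet e) w := by
      rw [h.1, hw.unique hv h.2, Context.poly, sub_self]
      exact zero_mem _
    cases hw with
    | @comm i j h =>
      rcases word_eq_mul hc with h | ⟨c', -, h⟩ | ⟨c', -, h⟩
      · exact same h
      · exact absurd h not_letter
      · exact absurd h not_letter
    | assoc i j l =>
      rcases word_eq_mul hc with h | ⟨c', -, h⟩ | ⟨c', rfl, h⟩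
      · exact same h
      · exact absurd h not_letter
      · rcases word_eq_mul h with ⟨rfl, rfl⟩ | ⟨c', -, h⟩ | ⟨c', -, h⟩
        -- The index must be a variable before `hv` can be split; a leading word of length two then
        -- leaves only a commutation relation.
        · generalize hu : of i * of j = u at hv
          cases hv with
          | @comm i' j' hij =>
            obtain ⟨hi, hj⟩ := mul_eq_mul_iff.1 hu
            obtain rfl := of_inj.1 hi
            obtain rfl := of_inj.1 hj
            exact P.assocRel_composition_mem_trivialSpan e hij l
          | assoc i' j' l' => exact absurd (mul_eq_mul_iff.1 hu).1 (of_ne_mul _ _ _)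
          | derived _ _ => exact absurd (mul_eq_mul_iff.1 hu).2 (of_ne_mul _ _ _)
        · exact absurd h not_letter
        · exact absurd h not_letter
    | @derived i j l hij hjl =>
      rcases word_eq_mul hc with h | ⟨c', rfl, h⟩ | ⟨c', -, h⟩
      · exact same h
      · rcases word_eq_mul h with ⟨rfl, rfl⟩ | ⟨c', -, h⟩ | ⟨c', -, h⟩
        · generalize hu : of j * of l = u at hv
          cases hv with
          | @comm i' j' hij =>
            obtain ⟨hi, hj⟩ := mul_eq_mul_iff.1 hu
            obtain rfl := of_inj.1 hi
            obtain rfl := of_inj.1 hj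
            -- Here the restriction $j\le l$ in the third family rules out an overlap with $e_je_l$.
            exact absurd hij hjl.not_gt
          | assoc i' j' l' => exact absurd (mul_eq_mul_iff.1 hu).1 (of_ne_mul _ _ _)
          | derived _ _ => exact absurd (mul_eq_mul_iff.1 hu).2 (of_ne_mul _ _ _)
        · exact absurd h not_letter
        · exact absurd h not_letter
      · exact absurd h not_letter

end GroebnerShirshov

open Classical in
theorem isLinear.{u, v} {k : Type u} {A : Type v} [Field k] [AddCommGroup A] [Module k A]
    (P : AkivisAlgebra k A) : P.IsLinear := by
  let e := Module.Basis.ofVectorSpace k A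
  -- Any linear order would do; it enters only through the model behind injectivity.
  let _ : LinearOrder (Module.Basis.ofVectorSpaceIndex k A) := linearOrderOfSTO WellOrderingRel
  exact ⟨P.Env e, inferInstance, inferInstance, inferInstance, inferInstance, P.toEnv e,
    P.toEnv_injective e, P.isHom_toEnv e⟩

end AkivisAlgebra

end

theorem mainTheorem8 {k A : Type*} [Field k] [AddCommGroup A] [Module k A]
    (P : AkivisAlgebra k A) :
    (∀ (I : Type*) [LinearOrder I] (e : Module.Basis I k A),
      (NonassocGS.IsGroebnerShirshovBasis NonassocGS.DegLex (P.gsSet e) ∧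
        (WellFoundedLT I →
          WellFounded (NonassocGS.DegLex : FreeMagma I → FreeMagma I → Prop)) ∧
        NonassocGS.idealSpan k (P.gsSet e) = NonassocGS.idealSpan k (P.envRel e)) ∧
      Function.Injective (P.toEnv e) ∧
      AkivisAlgebra.IsHom P (AkivisAlgebra.ofAlgebra k (P.Env e)) (P.toEnv e)) ∧
    P.IsLinear :=
  ⟨fun _ _ e => ⟨⟨P.isGroebnerShirshovBasis_gsSet e, fun _ => NonassocGS.wellFounded_degLex,
    P.idealSpan_gsSet e⟩, P.toEnv_injective e, P.isHom_toEnv e⟩, P.isLinear⟩
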